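/- Let $\alpha>1$. Consider the $\alpha$-P\'olya urn on the $n+1$ colours $0,1,\dots,n$ with initial state $(m,1,1,\dots,1)$: the urn initially contains $m$ balls of colour $0$ and one ball of each of the colours $1,\dots,n$, and at each step $1,2,3,\dots$, given the past, colour $i$ is selected with probability $N(i)^\alpha/\sum_{l=0}^{n}N(l)^\alpha$, where $N(l)$ is the current number of balls of colour $l$; one ball of the selected colour is then added to the urn. Then there is $m_0=m_0(\alpha)$ such that for every integer $m\ge m_0$ there exists $n=n(\alpha,m)\ge 5$ for which, with probability greater than $\frac45$, both of the following hold for the whole infinite sequence of selections: - only colour $0$ is selected more than $2m-1$ times (that is, colour $0$ is, and no other colour is); and - at least $5$ colours are selected exactly $m-1$ times. -/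

import Mathlib

open MeasureTheory

/-- The composition of an urn, as a function of the colour: the initial composition `x₀`, and one
more ball of the selected colour for each of the first `k` selections `c 0, …, c (k - 1)`. -/
def urnTally {n k : ℕ} (x₀ : Fin (n + 1) → ℕ) (c : Fin k → Fin (n + 1)) (i : Fin (n + 1)) : ℕ :=
  x₀ i + (Finset.univ.filter fun j : Fin k => c j = i).card

/-- The probability that the next selection is colour `i`, given the earlier selections `c`:
proportional to the current tally of colour `i` to the power `α`. -/
noncomputable def selectionProb {n k : ℕ} (α : ℝ) (x₀ : Fin (n + 1) → ℕ)
    (c : Fin k → Fin (n + 1)) (i : Fin (n + 1)) : ℝ :=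
  (urnTally x₀ c i : ℝ) ^ α / ∑ l, (urnTally x₀ c l : ℝ) ^ α

/-- `C k` is the colour selected at step `k + 1` of an `α`-Pólya urn with colours `0, …, n` and
initial composition `x₀`: on every possible history of the first `k` selections, the conditional
probability that the next selection is `i` is `selectionProb α x₀ c i`. -/
structure IsPolyaUrn {Ω : Type*} [MeasurableSpace Ω] (μ : Measure Ω) {n : ℕ} (α : ℝ)
    (x₀ : Fin (n + 1) → ℕ) (C : ℕ → Ω → Fin (n + 1)) : Prop where
  measurable (k : ℕ) : Measurable (C k)
  measure_next (k : ℕ) (c : Fin k → Fin (n + 1)) (i : Fin (n + 1)) :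
    μ.real {ω | (∀ j : Fin k, C j ω = c j) ∧ C k ω = i} =
      μ.real {ω | ∀ j : Fin k, C j ω = c j} * selectionProb α x₀ c i

/-- The initial composition `(m, 1, …, 1)` on the `n + 1` colours `0, …, n`. -/
def catAndMice (m n : ℕ) : Fin (n + 1) → ℕ := Fin.cons m fun _ => 1

/-- The (possibly infinite) number of times that colour `i` is selected in the whole sequence. -/
noncomputable def selectionCount {n : ℕ} (c : ℕ → Fin (n + 1)) (i : Fin (n + 1)) : ℕ∞ :=
  {k : ℕ | c k = i}.encard

open Filter Topology

/-! In continuous time the colours become independent pure birth processes, jumping from `a` to `a +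
1` at rate `a ^ α`, and the urn is their jump chain. As `α > 1`, colour 0 (the cat) explodes, at a
time with mean `powTail α m` and variance `σ ^ 2 = powTail (2 * α) m`, hence by Chernoff within `5σ`
of the mean. Let `p` bound from below the chance that a mouse is at level `m` from `6σ` before the
mean until `T`, `5σ` after it, and `q` from above its chance of passing `2 m` by time `T`. Both are
large deviation estimates with the same exponential tilt, of order `m ^ α`. The time window costs
`p` a factor `exp (O (√m))`, while the extra levels cost `q` a factor `exp (-l m)`. So `q / p` is
small, and `n ≈ 12 / p` mice give several at `m` and probably none above `2 m` (`exists_tilt`).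

No continuous-time process is built. The estimates are explicit supersolutions of the backward
equation, and `IsUrnSupersolution.urnValue_le` transfers them to the discrete urn. `catMiceBound`
adds four of them: cat late, cat early, some mouse too high, too few mice at `m`. The bound is
uniform in the number of selections, so `le_measureReal_of_frequently` and
`selectionCount_of_frequently` carry it to the infinite sequence. -/

/-! ### Tails of the zeta series -/

/-- The tail `∑_{j ≥ a} j⁻ˢ` of the zeta series. -/
noncomputable def powTail (s : ℝ) (a : ℕ) : ℝ := ∑' j : ℕ, (((j + a : ℕ) : ℝ) ^ s)⁻¹

lemma summable_powTail {s : ℝ} (hs : 1 < s) (a : ℕ) :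
    Summable fun j : ℕ => (((j + a : ℕ) : ℝ) ^ s)⁻¹ :=
  (summable_nat_add_iff (f := fun j : ℕ => ((j : ℝ) ^ s)⁻¹) a).2 (Real.summable_nat_rpow_inv.2 hs)

lemma powTail_eq_add_succ {s : ℝ} (hs : 1 < s) (a : ℕ) :
    powTail s a = ((a : ℝ) ^ s)⁻¹ + powTail s (a + 1) := by
  unfold powTail
  rw [(summable_powTail hs a).tsum_eq_zero_add]
  congr 1
  · simp
  · refine tsum_congr fun j => ?_
    rw [show j + 1 + a = j + (a + 1) by omega]

lemma powTail_nonneg (s : ℝ) (a : ℕ) : 0 ≤ powTail s a := tsum_nonneg fun _ => by positivity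

lemma tendsto_powTail (s : ℝ) : Tendsto (powTail s) atTop (𝓝 0) :=
  tendsto_sum_nat_add fun j : ℕ => ((j : ℝ) ^ s)⁻¹

lemma powTail_antitone {s : ℝ} (hs : 1 < s) : Antitone (powTail s) :=
  antitone_nat_of_succ_le fun a => by
    rw [powTail_eq_add_succ hs a]
    have : (0 : ℝ) ≤ ((a : ℝ) ^ s)⁻¹ := by positivity
    linarith

/-- A discrete integral comparison: `1 + y ≤ exp y` bounds `(x + 1) ^ (-s)` by the increment, and `x
+ 1 ≤ 2 x` costs the factor `2 ^ s`. -/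
lemma inv_rpow_le_telescope {s : ℝ} (hs : 1 < s) {x : ℝ} (hx : 1 ≤ x) :
    (x ^ s)⁻¹ ≤ 2 ^ s / (s - 1) * (x ^ (1 - s) - (x + 1) ^ (1 - s)) := by
  have hx0 : 0 < x := by linarith
  have hb : 0 < s - 1 := by linarith
  have h1 : (x + 1) ^ (1 - s) * (1 + (s - 1) * (1 / (x + 1))) ≤ x ^ (1 - s) := by
    have hlog : 1 / (x + 1) ≤ Real.log ((x + 1) / x) := by
      have := Real.one_sub_inv_le_log_of_pos (x := (x + 1) / x) (by positivity)
      refine le_trans (le_of_eq ?_) this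
      field_simp
      ring
    have hexp : 1 + (s - 1) * (1 / (x + 1)) ≤ ((x + 1) / x) ^ (s - 1) := by
      rw [Real.rpow_def_of_pos (by positivity)]
      have := Real.add_one_le_exp (Real.log ((x + 1) / x) * (s - 1))
      nlinarith
    calc (x + 1) ^ (1 - s) * (1 + (s - 1) * (1 / (x + 1)))
        ≤ (x + 1) ^ (1 - s) * ((x + 1) / x) ^ (s - 1) := by gcongr
      _ = x ^ (1 - s) := by
          rw [Real.div_rpow (by positivity) hx0.le, show 1 - s = -(s - 1) by ring,
            Real.rpow_neg (by positivity), Real.rpow_neg hx0.le]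
          have : 0 < (x + 1) ^ (s - 1) := by positivity
          field_simp
  have h2 : (s - 1) * ((x + 1) ^ s)⁻¹ ≤ x ^ (1 - s) - (x + 1) ^ (1 - s) := by
    have : (x + 1) ^ (1 - s) * (1 / (x + 1)) = ((x + 1) ^ s)⁻¹ := by
      rw [Real.rpow_sub (by positivity), Real.rpow_one]
      field_simp
    nlinarith
  have h3 : (x ^ s)⁻¹ ≤ 2 ^ s * ((x + 1) ^ s)⁻¹ := by
    rw [← div_eq_mul_inv, ← one_div, div_le_div_iff₀ (by positivity) (by positivity), one_mul,
      ← Real.mul_rpow (by norm_num) hx0.le]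
    exact Real.rpow_le_rpow (by positivity) (by linarith) (by linarith)
  calc (x ^ s)⁻¹ ≤ 2 ^ s * ((x + 1) ^ s)⁻¹ := h3
    _ = 2 ^ s / (s - 1) * ((s - 1) * ((x + 1) ^ s)⁻¹) := by field_simp
    _ ≤ _ := by gcongr

lemma powTail_le {s : ℝ} (hs : 1 < s) {a : ℕ} (ha : 1 ≤ a) :
    powTail s a ≤ 2 ^ s / (s - 1) * (a / (a : ℝ) ^ s) := by
  have ha' : (1 : ℝ) ≤ a := by exact_mod_cast ha
  have hb : 0 < s - 1 := by linarith
  refine (summable_powTail hs a).tsum_le_of_sum_range_le fun N => ?_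
  have key : ∀ N : ℕ, ∑ j ∈ Finset.range N, (((j + a : ℕ) : ℝ) ^ s)⁻¹ ≤
      2 ^ s / (s - 1) * ((a : ℝ) ^ (1 - s) - ((N + a : ℕ) : ℝ) ^ (1 - s)) := by
    intro N
    induction N with
    | zero => simp
    | succ N ih =>
      rw [Finset.sum_range_succ]
      have h := inv_rpow_le_telescope hs (x := ((N + a : ℕ) : ℝ)) (by exact_mod_cast (by omega))
      have e : ((N + 1 + a : ℕ) : ℝ) = ((N + a : ℕ) : ℝ) + 1 := by push_cast; ring
      rw [e]
      linarith
  refine (key N).trans ?_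
  have e : (a : ℝ) / (a : ℝ) ^ s = (a : ℝ) ^ (1 - s) := by
    rw [Real.rpow_sub (by positivity), Real.rpow_one]
  rw [e]
  have : (0 : ℝ) ≤ ((N + a : ℕ) : ℝ) ^ (1 - s) := by positivity
  gcongr
  linarith

lemma le_powTail {s : ℝ} (hs : 1 < s) {a : ℕ} (ha : 1 ≤ a) :
    a / (2 ^ s * (a : ℝ) ^ s) ≤ powTail s a := by
  have ha' : (1 : ℝ) ≤ a := by exact_mod_cast ha
  refine le_trans ?_ ((summable_powTail hs a).sum_le_tsum (Finset.range a) fun _ _ => by positivity)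
  calc (a : ℝ) / (2 ^ s * (a : ℝ) ^ s) = ∑ j ∈ Finset.range a, (2 ^ s * (a : ℝ) ^ s)⁻¹ := by
        simp [div_eq_mul_inv]
    _ ≤ _ := by
        refine Finset.sum_le_sum fun j hj => ?_
        have hj : j < a := Finset.mem_range.1 hj
        have : (0 : ℝ) < ((j + a : ℕ) : ℝ) := by exact_mod_cast (by omega)
        gcongr
        rw [← Real.mul_rpow (by norm_num) (by positivity)]
        refine Real.rpow_le_rpow this.le ?_ (by linarith)
        exact_mod_cast (by omega)

/-! ### Supersolutions of the backward equation and the comparison principle -/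

/-- `h a t` is a supersolution, at levels `a ≥ a₀` and times `t ≤ T`, of the backward equation of
the pure birth process with rates `a ^ α`. -/
def IsBirthSupersolution (α T : ℝ) (a₀ : ℕ) (h : ℕ → ℝ → ℝ) : Prop :=
  ∀ a, a₀ ≤ a → ∀ t ≤ T, ∃ d, HasDerivAt (h a) d t ∧
    d + (a : ℝ) ^ α * (h (a + 1) t - h a t) ≤ 0

section Supersolution

variable {ι : Type*} [Fintype ι] [DecidableEq ι]

/-- `f x t` is a supersolution, at states `x ≥ b` and times `t ≤ T`, of the backward equation of
independent pure birth processes with rates `x i ^ α`. -/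
def IsUrnSupersolution (α T : ℝ) (b : ι → ℕ) (f : (ι → ℕ) → ℝ → ℝ) : Prop :=
  ∀ x, b ≤ x → ∀ t ≤ T, ∃ d, HasDerivAt (f x) d t ∧
    d + ∑ i, (x i : ℝ) ^ α * (f (Function.update x i (x i + 1)) t - f x t) ≤ 0

lemma IsUrnSupersolution.add {α T : ℝ} {b : ι → ℕ} {f g : (ι → ℕ) → ℝ → ℝ}
    (hf : IsUrnSupersolution α T b f) (hg : IsUrnSupersolution α T b g) :
    IsUrnSupersolution α T b fun x t => f x t + g x t := by
  intro x hx t ht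
  obtain ⟨d, hd, hd'⟩ := hf x hx t ht
  obtain ⟨e, he, he'⟩ := hg x hx t ht
  refine ⟨d + e, hd.add he, ?_⟩
  have : ∀ i, (x i : ℝ) ^ α * (f (Function.update x i (x i + 1)) t +
      g (Function.update x i (x i + 1)) t - (f x t + g x t)) =
      (x i : ℝ) ^ α * (f (Function.update x i (x i + 1)) t - f x t) +
      (x i : ℝ) ^ α * (g (Function.update x i (x i + 1)) t - g x t) := fun i => by ring
  simp only [this, Finset.sum_add_distrib]
  linarith

lemma IsUrnSupersolution.const_mul {α T : ℝ} {b : ι → ℕ} {f : (ι → ℕ) → ℝ → ℝ}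
    (hf : IsUrnSupersolution α T b f) {c : ℝ} (hc : 0 ≤ c) :
    IsUrnSupersolution α T b fun x t => c * f x t := by
  intro x hx t ht
  obtain ⟨d, hd, hd'⟩ := hf x hx t ht
  refine ⟨c * d, hd.const_mul c, ?_⟩
  have : ∀ i, (x i : ℝ) ^ α * (c * f (Function.update x i (x i + 1)) t - c * f x t) =
      c * ((x i : ℝ) ^ α * (f (Function.update x i (x i + 1)) t - f x t)) := fun i => by ring
  simp only [this, ← Finset.mul_sum, ← mul_add]
  exact mul_nonpos_of_nonneg_of_nonpos hc hd'

lemma IsUrnSupersolution.sum {κ : Type*} {α T : ℝ} {b : ι → ℕ} {f : κ → (ι → ℕ) → ℝ → ℝ}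
    (s : Finset κ) (hf : ∀ k ∈ s, IsUrnSupersolution α T b (f k)) :
    IsUrnSupersolution α T b fun x t => ∑ k ∈ s, f k x t := by
  classical
  induction s using Finset.induction_on with
  | empty => exact fun x _ t _ => ⟨0, by simpa using hasDerivAt_const t (0 : ℝ), by simp⟩
  | insert k s hk ih =>
    simp only [Finset.sum_insert hk]
    exact (hf k (Finset.mem_insert_self k s)).add
      (ih fun l hl => hf l (Finset.mem_insert_of_mem hl))

lemma IsBirthSupersolution.urn {α T : ℝ} {b : ι → ℕ} {h : ℕ → ℝ → ℝ} (i : ι)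
    (hh : IsBirthSupersolution α T (b i) h) :
    IsUrnSupersolution α T b fun x t => h (x i) t := by
  intro x hx t ht
  obtain ⟨d, hd, hd'⟩ := hh (x i) (hx i) t ht
  refine ⟨d, hd, ?_⟩
  rw [Finset.sum_eq_single i]
  · simpa using hd'
  · intro j _ hj
    simp [Function.update_of_ne hj.symm]
  · simp

/-- Only one coordinate jumps at a time, so the generator obeys the product rule; nonnegativity of
the other factors preserves the sign. -/
lemma IsUrnSupersolution.prod {α T : ℝ} {b : ι → ℕ} {h : ι → ℕ → ℝ → ℝ}
    (hh : ∀ i, IsBirthSupersolution α T (b i) (h i))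
    (h0 : ∀ i a t, b i ≤ a → t ≤ T → 0 ≤ h i a t) :
    IsUrnSupersolution α T b fun x t => ∏ i, h i (x i) t := by
  intro x hx t ht
  choose d hd hd' using fun i => hh i (x i) (hx i) t ht
  refine ⟨∑ i, (∏ j ∈ Finset.univ.erase i, h j (x j) t) * d i, ?_, ?_⟩
  · simpa [smul_eq_mul] using HasDerivAt.fun_finsetProd (u := Finset.univ) fun i _ => hd i
  · rw [← Finset.sum_add_distrib]
    refine Finset.sum_nonpos fun i _ => ?_
    have e1 : ∏ j, h j (Function.update x i (x i + 1) j) t =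
        h i (x i + 1) t * ∏ j ∈ Finset.univ.erase i, h j (x j) t := by
      rw [← Finset.mul_prod_erase _ _ (Finset.mem_univ i)]
      congr 1
      · simp
      · refine Finset.prod_congr rfl fun j hj => ?_
        rw [Function.update_of_ne (Finset.ne_of_mem_erase hj)]
    beta_reduce
    rw [e1, ← Finset.mul_prod_erase _ (fun j => h j (x j) t) (Finset.mem_univ i)]
    have hP : 0 ≤ ∏ j ∈ Finset.univ.erase i, h j (x j) t :=
      Finset.prod_nonneg fun j _ => h0 j _ t (hx j) ht
    have := mul_nonpos_of_nonneg_of_nonpos hP (hd' i)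
    linarith

/-- The expectation of `φ` after `k` selections of the urn started from `x`. -/
noncomputable def urnValue (α : ℝ) (φ : (ι → ℕ) → ℝ) : ℕ → (ι → ℕ) → ℝ
  | 0, x => φ x
  | k + 1, x => ∑ i, (x i : ℝ) ^ α / (∑ l, (x l : ℝ) ^ α) *
      urnValue α φ k (Function.update x i (x i + 1))

lemma urnValue_le_one {α : ℝ} {φ : (ι → ℕ) → ℝ} (hφ : ∀ x, φ x ≤ 1) (k : ℕ) (x : ι → ℕ) :
    urnValue α φ k x ≤ 1 := by
  induction k generalizing x with
  | zero => exact hφ x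
  | succ k ih =>
    calc urnValue α φ (k + 1) x ≤ ∑ i, (x i : ℝ) ^ α / (∑ l, (x l : ℝ) ^ α) * 1 := by
          unfold urnValue
          exact Finset.sum_le_sum fun i _ => mul_le_mul_of_nonneg_left (ih _) (by positivity)
      _ ≤ 1 := by
          simp only [mul_one, ← Finset.sum_div]
          exact div_self_le_one _

lemma sum_mul_urnValue_succ (α : ℝ) (φ : (ι → ℕ) → ℝ) (k : ℕ) (x : ι → ℕ) :
    (∑ l, (x l : ℝ) ^ α) * urnValue α φ (k + 1) x =
      ∑ i, (x i : ℝ) ^ α * urnValue α φ k (Function.update x i (x i + 1)) := by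
  rw [urnValue, Finset.mul_sum]
  refine Finset.sum_congr rfl fun i _ => ?_
  rcases eq_or_ne (∑ l, (x l : ℝ) ^ α) 0 with h | h
  · have := (Finset.sum_eq_zero_iff_of_nonneg fun l _ => by positivity).1 h i (Finset.mem_univ i)
    simp [h, this]
  · field_simp

/-- Comparison principle: a supersolution that dominates `φ`, and is at least `1` at the terminal
time, dominates the expectations of `φ`. -/
lemma IsUrnSupersolution.urnValue_le {α T : ℝ} {b : ι → ℕ} {f : (ι → ℕ) → ℝ → ℝ}
    (hf : IsUrnSupersolution α T b f) {φ : (ι → ℕ) → ℝ} (hφ : ∀ x, φ x ≤ 1)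
    (hT : ∀ x, b ≤ x → 1 ≤ f x T) (hφf : ∀ x, b ≤ x → ∀ t ≤ T, φ x ≤ f x t) (k : ℕ) :
    ∀ x, b ≤ x → ∀ t ≤ T, urnValue α φ k x ≤ f x t := by
  induction k with
  | zero => exact hφf
  | succ k ih =>
    intro x hx t ht
    set R := ∑ l, (x l : ℝ) ^ α with hR
    set u := urnValue α φ (k + 1) x with hu
    choose! d hd hd' using hf x hx
    have hxi : ∀ i, b ≤ Function.update x i (x i + 1) := fun i j => by
      rcases eq_or_ne j i with rfl | h
      · simpa using (hx j).trans (Nat.le_succ _)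
      · simpa [Function.update_of_ne h] using hx j
    have hdle : ∀ s ≤ T, d s ≤ R * (f x s - u) := by
      intro s hs
      have h1 := hd' s hs
      have h2 : R * u ≤ ∑ i, (x i : ℝ) ^ α * f (Function.update x i (x i + 1)) s := by
        rw [hR, hu, sum_mul_urnValue_succ]
        exact Finset.sum_le_sum fun i _ =>
          mul_le_mul_of_nonneg_left (ih _ (hxi i) s hs) (by positivity)
      simp only [mul_sub, Finset.sum_sub_distrib, ← Finset.sum_mul] at h1
      rw [mul_sub]
      linarith
    -- By induction `∂ₜ f ≤ R (f - u)` with `u` constant in time, so this function decreases to its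
    -- value at `T`, which is nonnegative because `u ≤ 1 ≤ f`.
    have hanti : AntitoneOn (fun s => Real.exp (-R * s) * (f x s - u)) (Set.Iic T) := by
      have hder : ∀ s ≤ T, HasDerivAt (fun s => Real.exp (-R * s) * (f x s - u))
          (Real.exp (-R * s) * (-R) * (f x s - u) + Real.exp (-R * s) * d s) s := by
        intro s hs
        have h1 : HasDerivAt (fun s => Real.exp (-R * s)) (Real.exp (-R * s) * (-R)) s := by
          simpa using ((hasDerivAt_id s).const_mul (-R)).exp
        exact h1.mul ((hd s hs).sub_const u)
      refine antitoneOn_of_deriv_nonpos (convex_Iic T)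
        (fun s hs => (hder s hs).continuousAt.continuousWithinAt) ?_ ?_
      · intro s hs
        rw [interior_Iic] at hs
        exact (hder s (le_of_lt hs)).differentiableAt.differentiableWithinAt
      · intro s hs
        rw [interior_Iic] at hs
        rw [(hder s (le_of_lt hs)).deriv]
        have := mul_le_mul_of_nonneg_left (hdle s (le_of_lt hs)) (Real.exp_pos (-R * s)).le
        linarith
    have h1 := hanti (Set.mem_Iic.2 ht) (Set.mem_Iic.2 le_rfl) ht
    have h2 : 0 ≤ Real.exp (-R * T) * (f x T - u) :=
      mul_nonneg (Real.exp_pos _).le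
        (sub_nonneg.2 ((urnValue_le_one hφ (k + 1) x).trans (hT x hx)))
    have h3 : 0 ≤ f x t - u := nonneg_of_mul_nonneg_right (h2.trans h1) (Real.exp_pos _)
    linarith

end Supersolution

/-! ### The law of the composition -/

section Urn

variable {Ω : Type*} [MeasurableSpace Ω] {μ : Measure Ω} [IsProbabilityMeasure μ] {n : ℕ}

lemma urnTally_snoc {k : ℕ} (x₀ : Fin (n + 1) → ℕ) (c : Fin k → Fin (n + 1)) (i : Fin (n + 1)) :
    urnTally x₀ (Fin.snoc c i : Fin (k + 1) → Fin (n + 1)) =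
      Function.update (urnTally x₀ c) i (urnTally x₀ c i + 1) := by
  ext l
  have : (Finset.univ.filter fun j : Fin (k + 1) =>
      (Fin.snoc c i : Fin (k + 1) → Fin (n + 1)) j = l).card =
      (Finset.univ.filter fun j : Fin k => c j = l).card + if i = l then 1 else 0 := by
    simp only [Finset.card_filter, Fin.sum_univ_castSucc, Fin.snoc_castSucc, Fin.snoc_last]
  unfold urnTally
  rw [this]
  rcases eq_or_ne l i with rfl | h
  · simp [add_assoc]
  · simp [Function.update_of_ne h, h.symm]

/-- The induction is on the number of selections still to come, for all histories at once: splitting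
by the next selection costs one use of `measure_next`. -/
lemma IsPolyaUrn.measureReal_history_inter {α : ℝ} {x₀ : Fin (n + 1) → ℕ}
    {C : ℕ → Ω → Fin (n + 1)} (h : IsPolyaUrn μ α x₀ C) (B : Set (Fin (n + 1) → ℕ)) (j : ℕ) :
    ∀ (k : ℕ) (c : Fin k → Fin (n + 1)),
      μ.real {ω | (∀ l : Fin k, C l ω = c l) ∧ urnTally x₀ (fun l : Fin (j + k) => C l ω) ∈ B} =
        μ.real {ω | ∀ l : Fin k, C l ω = c l} *
          urnValue α (B.indicator 1) j (urnTally x₀ c) := by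
  have hmeas : ∀ (k : ℕ) (c : Fin k → Fin (n + 1)),
      MeasurableSet {ω | ∀ l : Fin k, C l ω = c l} := fun k c => by
    simp only [Set.ofPred_forall]
    exact MeasurableSet.iInter fun l => h.measurable l (measurableSet_singleton _)
  have hB : ∀ k, MeasurableSet {ω | urnTally x₀ (fun l : Fin k => C l ω) ∈ B} := fun k => by
    have h1 : Measurable fun ω => (fun l : Fin k => C l ω) :=
      measurable_pi_lambda _ fun l => h.measurable l
    exact h1 (MeasurableSet.of_discrete (s := {c | urnTally x₀ c ∈ B}))
  induction j with
  | zero =>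
    intro k c
    rw [Nat.zero_add]
    by_cases hc : urnTally x₀ c ∈ B
    · simp only [urnValue, Set.indicator_of_mem hc, Pi.one_apply, mul_one]
      congr 1
      ext ω
      simp only [Set.mem_ofPred_eq, and_iff_left_iff_imp]
      intro hω
      rwa [show (fun l : Fin k => C l ω) = c from funext hω]
    · simp only [urnValue, Set.indicator_of_notMem hc, mul_zero]
      convert measureReal_empty
      ext ω
      simp only [Set.mem_ofPred_eq, Set.mem_empty_iff_false, iff_false, not_and]
      intro hω
      rwa [show (fun l : Fin k => C l ω) = c from funext hω]
  | succ j ih =>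
    intro k c
    have hsnoc : ∀ i ω, (∀ l : Fin (k + 1), C l ω = (Fin.snoc c i : Fin (k + 1) → Fin (n + 1)) l) ↔
        (∀ l : Fin k, C l ω = c l) ∧ C k ω = i := by
      intro i ω
      simp [Fin.forall_fin_succ']
    have e : {ω | (∀ l : Fin k, C l ω = c l) ∧
        urnTally x₀ (fun l : Fin (j + 1 + k) => C l ω) ∈ B} =
        ⋃ i ∈ (Finset.univ : Finset (Fin (n + 1))), {ω | (∀ l : Fin (k + 1), C l ω =
          (Fin.snoc c i : Fin (k + 1) → Fin (n + 1)) l) ∧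
          urnTally x₀ (fun l : Fin (j + (k + 1)) => C l ω) ∈ B} := by
      ext ω
      simp only [Set.mem_ofPred_eq, Set.mem_iUnion, hsnoc, Finset.mem_univ, exists_prop, true_and]
      rw [show j + 1 + k = j + (k + 1) by omega]
      constructor
      · exact fun hω => ⟨_, ⟨hω.1, rfl⟩, hω.2⟩
      · exact fun ⟨i, hω, hB⟩ => ⟨hω.1, hB⟩
    rw [e, measureReal_biUnion_finset]
    · rw [urnValue, Finset.mul_sum]
      refine Finset.sum_congr rfl fun i _ => ?_
      rw [ih, urnTally_snoc]
      simp only [hsnoc]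
      rw [h.measure_next, selectionProb, mul_assoc]
    · intro i _ i' _ hii'
      refine Set.disjoint_left.2 fun ω hω hω' => hii' ?_
      rw [← ((hsnoc i ω).1 hω.1).2, ((hsnoc i' ω).1 hω'.1).2]
    · exact fun i _ => (hmeas _ _).inter (hB _)

/-- The law of the composition after `k` selections. -/
lemma IsPolyaUrn.measureReal_tally_mem {α : ℝ} {x₀ : Fin (n + 1) → ℕ}
    {C : ℕ → Ω → Fin (n + 1)} (h : IsPolyaUrn μ α x₀ C) (B : Set (Fin (n + 1) → ℕ)) (k : ℕ) :
    μ.real {ω | urnTally x₀ (fun l : Fin k => C l ω) ∈ B} =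
      urnValue α (B.indicator 1) k x₀ := by
  have e : urnTally x₀ (Fin.elim0 : Fin 0 → Fin (n + 1)) = x₀ := by
    ext i
    simp [urnTally]
  simpa [e] using h.measureReal_history_inter B k 0 Fin.elim0

end Urn

/-! ### Chernoff bounds for the explosion time of the cat -/

lemma IsBirthSupersolution.of_exp {α T c : ℝ} {a₀ : ℕ} {ψ : ℕ → ℝ}
    (h : ∀ a, a₀ ≤ a → c + (a : ℝ) ^ α * (Real.exp (ψ (a + 1) - ψ a) - 1) ≤ 0) :
    IsBirthSupersolution α T a₀ fun a t => Real.exp (c * t + ψ a) := by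
  intro a ha t _
  refine ⟨Real.exp (c * t + ψ a) * c, ?_, ?_⟩
  · simpa using (((hasDerivAt_id t).const_mul c).add_const (ψ a)).exp
  · have e : Real.exp (c * t + ψ (a + 1)) =
        Real.exp (c * t + ψ a) * Real.exp (ψ (a + 1) - ψ a) := by
      rw [← Real.exp_add]
      ring_nf
    beta_reduce
    rw [e]
    have := mul_nonpos_of_nonneg_of_nonpos (Real.exp_pos (c * t + ψ a)).le (h a ha)
    linarith

/-- The Chernoff bound for a late explosion of the birth process. -/
lemma isBirthSupersolution_late {α : ℝ} (hα : 1 < α) (T : ℝ) {θ : ℝ} {m : ℕ} (hm : 1 ≤ m)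
    (hθ : 0 ≤ θ) (hθm : 2 * θ ≤ (m : ℝ) ^ α) :
    IsBirthSupersolution α T m fun a t =>
      Real.exp (θ * t + (-(θ * T) + θ * powTail α a + θ ^ 2 * powTail (2 * α) a)) := by
  refine IsBirthSupersolution.of_exp
    (ψ := fun a => -(θ * T) + θ * powTail α a + θ ^ 2 * powTail (2 * α) a) fun a ha => ?_
  have ha0 : (0 : ℝ) < a := by exact_mod_cast (by omega)
  have hr : 0 < (a : ℝ) ^ α := by positivity
  have hra : 2 * θ ≤ (a : ℝ) ^ α := hθm.trans
    (Real.rpow_le_rpow (by positivity) (by exact_mod_cast ha) (by linarith))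
  have h2 : (a : ℝ) ^ (2 * α) = ((a : ℝ) ^ α) ^ 2 := by
    rw [← Real.rpow_natCast, ← Real.rpow_mul ha0.le]
    norm_num [mul_comm]
  rw [powTail_eq_add_succ hα a, powTail_eq_add_succ (s := 2 * α) (by linarith) a, h2]
  set r := (a : ℝ) ^ α
  have hy : θ / r ≤ 1 / 2 := by rw [div_le_iff₀ hr]; linarith
  have hy0 : 0 ≤ θ / r := by positivity
  set y := θ / r with hydef
  have hθr : θ = r * y := by rw [hydef]; field_simp
  have e : -(θ * T) + θ * powTail α (a + 1) + θ ^ 2 * powTail (2 * α) (a + 1) -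
      (-(θ * T) + θ * (r⁻¹ + powTail α (a + 1)) +
        θ ^ 2 * ((r ^ 2)⁻¹ + powTail (2 * α) (a + 1))) = -(y + y ^ 2) := by
    rw [hydef]; ring
  rw [e]
  -- That is, `-log (1 - y) ≤ y + y ^ 2`, the second-order bound for an exponential holding time; it
  -- needs `y ≤ 1 / 2`, hence `hθm`.
  have h3 : Real.exp (-(y + y ^ 2)) ≤ 1 - y := by
    rw [Real.exp_neg, inv_le_comm₀ (Real.exp_pos _) (by linarith)]
    refine le_trans ?_ (Real.quadratic_le_exp_of_nonneg (x := y + y ^ 2) (by positivity))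
    rw [inv_le_iff_one_le_mul₀ (by linarith)]
    have h4 := mul_nonneg (sq_nonneg y) (sub_nonneg.2 hy)
    have h5 := mul_nonneg (pow_nonneg hy0 4) (sub_nonneg.2 hy)
    have h6 := mul_nonneg (pow_nonneg hy0 3) (sub_nonneg.2 hy)
    nlinarith [pow_nonneg hy0 4, sq_nonneg y, pow_nonneg hy0 3]
  rw [hθr]
  nlinarith

/-- The Chernoff bound for an early explosion of the birth process. -/
lemma isBirthSupersolution_early {α : ℝ} (hα : 1 < α) (T T' : ℝ) {θ : ℝ} {m : ℕ} (hm : 1 ≤ m)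
    (hθ : 0 ≤ θ) :
    IsBirthSupersolution α T m fun a t =>
      Real.exp (-θ * t + (θ * T' - θ * powTail α a + θ ^ 2 * powTail (2 * α) a)) := by
  refine IsBirthSupersolution.of_exp
    (ψ := fun a => θ * T' - θ * powTail α a + θ ^ 2 * powTail (2 * α) a) fun a ha => ?_
  have ha0 : (0 : ℝ) < a := by exact_mod_cast (by omega)
  have hr : 0 < (a : ℝ) ^ α := by positivity
  have h2 : (a : ℝ) ^ (2 * α) = ((a : ℝ) ^ α) ^ 2 := by
    rw [← Real.rpow_natCast, ← Real.rpow_mul ha0.le]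
    norm_num [mul_comm]
  rw [powTail_eq_add_succ hα a, powTail_eq_add_succ (s := 2 * α) (by linarith) a, h2]
  set r := (a : ℝ) ^ α
  have hy0 : 0 ≤ θ / r := by positivity
  set y := θ / r with hydef
  have hθr : θ = r * y := by rw [hydef]; field_simp
  have e : θ * T' - θ * powTail α (a + 1) + θ ^ 2 * powTail (2 * α) (a + 1) -
      (θ * T' - θ * (r⁻¹ + powTail α (a + 1)) +
        θ ^ 2 * ((r ^ 2)⁻¹ + powTail (2 * α) (a + 1))) = y - y ^ 2 := by
    rw [hydef]; ring
  rw [e]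
  have h3 : Real.exp (y - y ^ 2) ≤ 1 + y := by
    have h4 := Real.add_one_le_exp (-(y - y ^ 2))
    have h5 : 0 < -(y - y ^ 2) + 1 := by nlinarith [sq_nonneg (y - 1)]
    rw [show y - y ^ 2 = -(-(y - y ^ 2)) by ring, Real.exp_neg]
    refine (inv_anti₀ h5 h4).trans ?_
    rw [inv_le_iff_one_le_mul₀ h5]
    nlinarith [pow_nonneg hy0 3]
  rw [hθr]
  nlinarith

/-! ### Exponential tilting for a single mouse -/

/-- The exponential tilt by `lam` of the passage from level `a` to level `b`. -/
noncomputable def tiltProd (α lam : ℝ) (a b : ℕ) : ℝ :=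
  ∏ j ∈ Finset.Ico a b, (j : ℝ) ^ α / ((j : ℝ) ^ α + lam)

/-- The mean of the tilted passage time from level `a` to level `b`. -/
noncomputable def tiltMean (α lam : ℝ) (a b : ℕ) : ℝ :=
  ∑ j ∈ Finset.Ico a b, ((j : ℝ) ^ α + lam)⁻¹

/-- The variance of the tilted passage time from level `a` to level `b`. -/
noncomputable def tiltVar (α lam : ℝ) (a b : ℕ) : ℝ :=
  ∑ j ∈ Finset.Ico a b, (((j : ℝ) ^ α + lam)⁻¹) ^ 2

section Tilt

variable {α lam : ℝ}

lemma tiltProd_eq_mul_succ (α lam : ℝ) {a b : ℕ} (h : a < b) :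
    tiltProd α lam a b = (a : ℝ) ^ α / ((a : ℝ) ^ α + lam) * tiltProd α lam (a + 1) b :=
  Finset.prod_eq_prod_Ico_succ_bot h _

lemma tiltMean_eq_add_succ (α lam : ℝ) {a b : ℕ} (h : a < b) :
    tiltMean α lam a b = ((a : ℝ) ^ α + lam)⁻¹ + tiltMean α lam (a + 1) b :=
  Finset.sum_eq_sum_Ico_succ_bot h _

lemma tiltVar_eq_add_succ (α lam : ℝ) {a b : ℕ} (h : a < b) :
    tiltVar α lam a b = (((a : ℝ) ^ α + lam)⁻¹) ^ 2 + tiltVar α lam (a + 1) b :=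
  Finset.sum_eq_sum_Ico_succ_bot h _

lemma tiltProd_nonneg (hlam : 0 < lam) (a b : ℕ) : 0 ≤ tiltProd α lam a b :=
  Finset.prod_nonneg fun _ _ => by positivity

lemma tiltProd_pos (hlam : 0 < lam) {a : ℕ} (ha : 1 ≤ a) (b : ℕ) : 0 < tiltProd α lam a b := by
  refine Finset.prod_pos fun j hj => ?_
  have : (0 : ℝ) < j := by
    have := (Finset.mem_Ico.1 hj).1
    exact_mod_cast (by omega)
  positivity

lemma tiltMean_nonneg (hlam : 0 < lam) (a b : ℕ) : 0 ≤ tiltMean α lam a b :=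
  Finset.sum_nonneg fun _ _ => by positivity

lemma tiltVar_nonneg (a b : ℕ) : 0 ≤ tiltVar α lam a b :=
  Finset.sum_nonneg fun _ _ => by positivity

lemma tiltProd_le_exp (hlam : 0 < lam) (a b : ℕ) :
    tiltProd α lam a b ≤ Real.exp (-(lam * tiltMean α lam a b)) := by
  rw [tiltMean, Finset.mul_sum, ← Finset.sum_neg_distrib, Real.exp_sum]
  refine Finset.prod_le_prod (fun _ _ => by positivity) fun j _ => ?_
  have := Real.add_one_le_exp (-(lam * ((j : ℝ) ^ α + lam)⁻¹))
  refine le_trans (le_of_eq ?_) this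
  have : (0 : ℝ) < (j : ℝ) ^ α + lam := by positivity
  field_simp
  ring

/-- The Chernoff bound for reaching level `b` before time `T`. -/
noncomputable def reachBound (α lam T : ℝ) (b a : ℕ) (t : ℝ) : ℝ :=
  Real.exp (lam * (T - t)) * tiltProd α lam a b

lemma reachBound_nonneg (hlam : 0 < lam) (T : ℝ) (b a : ℕ) (t : ℝ) :
    0 ≤ reachBound α lam T b a t :=
  mul_nonneg (Real.exp_pos _).le (tiltProd_nonneg hlam a b)

lemma one_le_reachBound (hlam : 0 < lam) {T t : ℝ} (ht : t ≤ T) {a b : ℕ} (hab : b ≤ a) :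
    1 ≤ reachBound α lam T b a t := by
  rw [reachBound, tiltProd, Finset.Ico_eq_empty (by omega), Finset.prod_empty, mul_one]
  exact Real.one_le_exp (mul_nonneg hlam.le (by linarith))

/-- Below `b` this is an exact solution, `tiltProd` being the Laplace transform of the passage time;
from `b` on it is constant in the level and decreasing in time. -/
lemma isBirthSupersolution_reachBound (hlam : 0 < lam) (T : ℝ) (b : ℕ) (a₀ : ℕ) :
    IsBirthSupersolution α T a₀ (reachBound α lam T b) := by
  intro a _ t _
  have h1 : HasDerivAt (fun t => Real.exp (lam * (T - t))) (Real.exp (lam * (T - t)) * (-lam)) t := by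
    simpa using (((hasDerivAt_id t).const_sub T).const_mul lam).exp
  refine ⟨_, h1.mul_const (tiltProd α lam a b), ?_⟩
  unfold reachBound
  have hE := Real.exp_pos (lam * (T - t))
  rcases lt_or_ge a b with hab | hab
  · rw [tiltProd_eq_mul_succ α lam hab]
    have : (0 : ℝ) < (a : ℝ) ^ α + lam := by positivity
    refine le_of_eq ?_
    field_simp
    ring
  · have e : tiltProd α lam (a + 1) b = tiltProd α lam a b := by
      simp [tiltProd, Finset.Ico_eq_empty (show ¬ a < b by omega),
        Finset.Ico_eq_empty (show ¬ a + 1 < b by omega)]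
    rw [e, sub_self, mul_zero, add_zero]
    have := mul_nonneg (mul_nonneg hE.le hlam.le) (tiltProd_nonneg (α := α) hlam a b)
    linarith

/-- A lower bound for the probability of being at level `a` at time `t`, reaching level `m` in the
time window `[μ - w, μ + w]`, and staying there until time `T`. -/
noncomputable def hitBound (α lam T μ w : ℝ) (m a : ℕ) (t : ℝ) : ℝ :=
  Real.exp (lam * (μ - w - t) - (m : ℝ) ^ α * (T - μ + w)) * tiltProd α lam a m *
    (1 - ((t + tiltMean α lam a m - μ) ^ 2 + tiltVar α lam a m) / w ^ 2)

/-- The last factor of `hitBound` is the tilted expectation of `1 - (τ - μ) ^ 2 / w ^ 2`, with `τ`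
the hitting time of `m`. This parabola lies below the indicator of the window, which builds in
Chebyshev's inequality and still solves the equation exactly. -/
lemma hasDerivAt_hitBound (α lam T μ w : ℝ) (hlam : 0 < lam) {m a : ℕ} (ham : a < m) (t : ℝ) :
    HasDerivAt (hitBound α lam T μ w m a)
      (-((a : ℝ) ^ α * (hitBound α lam T μ w m (a + 1) t - hitBound α lam T μ w m a t))) t := by
  have h1 : HasDerivAt (fun t => Real.exp (lam * (μ - w - t) - (m : ℝ) ^ α * (T - μ + w)))
      (Real.exp (lam * (μ - w - t) - (m : ℝ) ^ α * (T - μ + w)) * (-lam)) t := by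
    simpa using ((((hasDerivAt_id t).const_sub (μ - w)).const_mul lam).sub_const
      ((m : ℝ) ^ α * (T - μ + w))).exp
  have h2 : HasDerivAt (fun t => 1 - ((t + tiltMean α lam a m - μ) ^ 2 + tiltVar α lam a m) / w ^ 2)
      (-(2 * (t + tiltMean α lam a m - μ) / w ^ 2)) t := by
    simpa using ((((((hasDerivAt_id t).add_const (tiltMean α lam a m)).sub_const μ).pow 2).add_const
      (tiltVar α lam a m)).div_const (w ^ 2)).const_sub 1
  refine ((h1.mul_const (tiltProd α lam a m)).mul h2).congr_deriv ?_
  unfold hitBound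
  rw [tiltProd_eq_mul_succ α lam ham, tiltMean_eq_add_succ α lam ham, tiltVar_eq_add_succ α lam ham]
  have hr : (0 : ℝ) < (a : ℝ) ^ α + lam := by positivity
  set r := (a : ℝ) ^ α
  set E := Real.exp (lam * (μ - w - t) - (m : ℝ) ^ α * (T - μ + w))
  set P := tiltProd α lam (a + 1) m
  set M := tiltMean α lam (a + 1) m
  set v := tiltVar α lam (a + 1) m
  obtain ⟨d, hd⟩ : ∃ d, d = (r + lam)⁻¹ := ⟨_, rfl⟩
  have hdr : d * (r + lam) = 1 := by rw [hd]; field_simp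
  rw [div_eq_mul_inv r, ← hd]
  rcases eq_or_ne (w ^ 2) 0 with hw | hw
  · rw [hw]
    simp only [div_zero, sub_zero, neg_zero, mul_zero, add_zero, mul_one]
    linear_combination (-(E * P * r)) * hdr
  · obtain ⟨z, hz⟩ : ∃ z, z = (w ^ 2)⁻¹ := ⟨_, rfl⟩
    simp only [div_eq_mul_inv, ← hz]
    linear_combination
      (E * P * r * (-1 + z * ((t + M - μ) ^ 2 + v + 2 * d * (t + M - μ) + 2 * d ^ 2))) * hdr

/-- Before `μ - w` the parabola is nonpositive; afterwards the waiting time `T - μ + w` already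
charged is at least `T - t`. So changing formula at level `m` only increases `stayBound`. -/
lemma hitBound_le_exp (α T μ w : ℝ) (hlam : 0 < lam) (hw : 0 < w) (m : ℕ) (t : ℝ) :
    hitBound α lam T μ w m m t ≤ Real.exp (-((m : ℝ) ^ α * (T - t))) := by
  have hE := Real.exp_pos (lam * (μ - w - t) - (m : ℝ) ^ α * (T - μ + w))
  simp only [hitBound, tiltProd, tiltMean, tiltVar, Finset.Ico_self, Finset.prod_empty,
    Finset.sum_empty, add_zero, mul_one]
  rcases le_or_gt (μ - w) t with h | h
  · have h1 : 1 - (t - μ) ^ 2 / w ^ 2 ≤ 1 := by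
      have : 0 ≤ (t - μ) ^ 2 / w ^ 2 := by positivity
      linarith
    calc _ ≤ Real.exp (lam * (μ - w - t) - (m : ℝ) ^ α * (T - μ + w)) * 1 := by gcongr
      _ ≤ _ := by
        rw [mul_one]
        refine Real.exp_le_exp.2 ?_
        have h2 : 0 ≤ (m : ℝ) ^ α * (t - (μ - w)) := mul_nonneg (by positivity) (by linarith)
        have h3 : 0 ≤ lam * (t - (μ - w)) := mul_nonneg hlam.le (by linarith)
        nlinarith
  · have h1 : 1 - (t - μ) ^ 2 / w ^ 2 ≤ 0 := by
      rw [sub_nonpos, one_le_div (by positivity)]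
      nlinarith
    exact (mul_nonpos_of_nonneg_of_nonpos hE.le h1).trans (Real.exp_pos _).le

lemma hitBound_nonpos (α T μ : ℝ) {w : ℝ} (hlam : 0 < lam) (hw : 0 < w) {m a : ℕ} {t : ℝ}
    (ht : w ≤ |t + tiltMean α lam a m - μ|) : hitBound α lam T μ w m a t ≤ 0 := by
  refine mul_nonpos_of_nonneg_of_nonpos
    (mul_nonneg (Real.exp_pos _).le (tiltProd_nonneg hlam a m)) ?_
  rw [sub_nonpos, one_le_div (by positivity)]
  have h1 := tiltVar_nonneg (α := α) (lam := lam) a m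
  have h2 : w ^ 2 ≤ (t + tiltMean α lam a m - μ) ^ 2 := by
    rw [← sq_abs (t + tiltMean α lam a m - μ)]
    gcongr
  linarith

lemma hitBound_le_one {α T μ w : ℝ} (hlam : 0 < lam) (hw : 0 < w) (hT : μ - w ≤ T) (m a : ℕ)
    (t : ℝ) : hitBound α lam T μ w m a t ≤ 1 := by
  rcases le_or_gt w |t + tiltMean α lam a m - μ| with h | h
  · exact (hitBound_nonpos α T μ hlam hw h).trans zero_le_one
  · have h0 := (abs_lt.1 h).1
    have h1 : 1 - ((t + tiltMean α lam a m - μ) ^ 2 + tiltVar α lam a m) / w ^ 2 ≤ 1 := by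
      have := tiltVar_nonneg (α := α) (lam := lam) a m
      have : 0 ≤ ((t + tiltMean α lam a m - μ) ^ 2 + tiltVar α lam a m) / w ^ 2 := by positivity
      linarith
    have hP := tiltProd_nonneg (α := α) hlam a m
    calc hitBound α lam T μ w m a t
        ≤ Real.exp (lam * (μ - w - t) - (m : ℝ) ^ α * (T - μ + w)) * tiltProd α lam a m * 1 :=
          mul_le_mul_of_nonneg_left h1 (mul_nonneg (Real.exp_pos _).le hP)
      _ ≤ Real.exp (lam * (μ - w - t) - (m : ℝ) ^ α * (T - μ + w)) *
            Real.exp (-(lam * tiltMean α lam a m)) * 1 := by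
          gcongr
          exact tiltProd_le_exp hlam a m
      _ ≤ 1 := by
          rw [mul_one, ← Real.exp_add, Real.exp_le_one_iff]
          have h2 : 0 ≤ (m : ℝ) ^ α * (T - μ + w) := mul_nonneg (by positivity) (by linarith)
          have h3 : 0 ≤ lam * (t + tiltMean α lam a m - (μ - w)) :=
            mul_nonneg hlam.le (by linarith)
          nlinarith

/-- A lower bound, at every level `a`, for the probability of being at level `m` at time `T`. -/
noncomputable def stayBound (α lam T μ w : ℝ) (m a : ℕ) (t : ℝ) : ℝ :=
  if a < m then hitBound α lam T μ w m a t
  else if a = m then Real.exp (-((m : ℝ) ^ α * (T - t))) else 0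

lemma stayBound_le_one {α T μ w : ℝ} (hlam : 0 < lam) (hw : 0 < w) (hT : μ - w ≤ T) (m a : ℕ)
    {t : ℝ} (ht : t ≤ T) : stayBound α lam T μ w m a t ≤ 1 := by
  unfold stayBound
  split_ifs
  · exact hitBound_le_one hlam hw hT m a t
  · rw [Real.exp_le_one_iff]
    have : 0 ≤ (m : ℝ) ^ α * (T - t) := mul_nonneg (by positivity) (by linarith)
    linarith
  · exact zero_le_one

lemma stayBound_nonpos {α T μ w : ℝ} (hlam : 0 < lam) (hw : 0 < w) {m a : ℕ} (ha : a ≠ m)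
    {t : ℝ} (ht : μ + w ≤ t) : stayBound α lam T μ w m a t ≤ 0 := by
  unfold stayBound
  split_ifs
  · refine hitBound_nonpos α T μ hlam hw (le_trans ?_ (le_abs_self _))
    have := tiltMean_nonneg (α := α) hlam a m
    linarith
  · exact le_rfl

/-- `stayBound` is a subsolution. The form `1 - s / 2` bounds the mean of a factor `1 / 2` paid by a
mouse that ends at `m`, so the product over mice controls the mean of `2 ^ (-count)`. -/
lemma isBirthSupersolution_stayBound {α T μ w : ℝ} (hlam : 0 < lam) (hw : 0 < w) (m a₀ : ℕ) :
    IsBirthSupersolution α T a₀ fun a t => 1 - stayBound α lam T μ w m a t / 2 := by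
  intro a _ t _
  rcases lt_trichotomy a m with h | h | h
  · have e : stayBound α lam T μ w m a = hitBound α lam T μ w m a := by
      ext s
      simp [stayBound, h]
    have h1 : hitBound α lam T μ w m (a + 1) t ≤ stayBound α lam T μ w m (a + 1) t := by
      rcases lt_or_eq_of_le (Nat.succ_le_of_lt h) with h' | h'
      · simp [stayBound, h']
      · have h'' : a + 1 = m := h'
        subst h''
        simpa [stayBound] using hitBound_le_exp α T μ w hlam hw (a + 1) t
    have h2 := ((hasDerivAt_hitBound α lam T μ w hlam h t).div_const 2).const_sub 1
    rw [← e] at h2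
    refine ⟨_, h2, ?_⟩
    have := mul_le_mul_of_nonneg_left h1 (by positivity : (0 : ℝ) ≤ (a : ℝ) ^ α)
    linarith
  · subst h
    have e : stayBound α lam T μ w a a = fun t => Real.exp (-((a : ℝ) ^ α * (T - t))) := by
      ext s
      simp [stayBound]
    have h1 : HasDerivAt (fun t => Real.exp (-((a : ℝ) ^ α * (T - t))))
        (Real.exp (-((a : ℝ) ^ α * (T - t))) * (a : ℝ) ^ α) t := by
      simpa using (((hasDerivAt_id t).const_sub T).const_mul ((a : ℝ) ^ α)).neg.exp
    refine ⟨_, by beta_reduce; rw [e]; exact (h1.div_const 2).const_sub 1, ?_⟩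
    have e' : stayBound α lam T μ w a (a + 1) t = 0 := by simp [stayBound]
    beta_reduce
    rw [e, e']
    refine le_of_eq ?_
    ring
  · have e : ∀ b, m < b → stayBound α lam T μ w m b = fun _ => 0 := fun b hb => by
      ext s
      simp [stayBound, hb.not_gt, hb.ne']
    refine ⟨0, by beta_reduce; rw [e a h]; exact hasDerivAt_const _ _, ?_⟩
    beta_reduce
    rw [e a h, e (a + 1) (by omega)]
    simp

lemma exp_mul_tiltProd_le_stayBound {α T μ w : ℝ} (hlam : 0 < lam) (hw : 0 < w) {m a : ℕ}
    (ham : a < m) (hμ : tiltMean α lam a m = μ) (hv : 2 * tiltVar α lam a m ≤ w ^ 2) :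
    Real.exp (lam * (μ - w) - (m : ℝ) ^ α * (T - μ + w)) * tiltProd α lam a m / 2 ≤
      stayBound α lam T μ w m a 0 := by
  have hP := tiltProd_nonneg (α := α) hlam a m
  simp only [stayBound, if_pos ham, hitBound, sub_zero, hμ, zero_add, sub_self]
  rw [div_eq_mul_inv]
  refine mul_le_mul_of_nonneg_left ?_ (mul_nonneg (Real.exp_pos _).le hP)
  have : (0 ^ 2 + tiltVar α lam a m) / w ^ 2 ≤ 1 / 2 := by
    rw [div_le_iff₀ (by positivity)]
    linarith
  linarith

end Tilt

/-! ### Choice of the tilt -/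

lemma exp_neg_natCast_le (k : ℕ) : Real.exp (-k) ≤ (2.7 ^ k)⁻¹ := by
  have h : (2.7 : ℝ) ≤ Real.exp 1 := by linarith [Real.exp_one_gt_d9]
  rw [Real.exp_neg, ← Real.exp_one_pow]
  gcongr

lemma tiltProd_mul_tiltProd (α lam : ℝ) {a b c : ℕ} (hab : a ≤ b) (hbc : b ≤ c) :
    tiltProd α lam a b * tiltProd α lam b c = tiltProd α lam a c :=
  Finset.prod_Ico_consecutive _ hab hbc

lemma tiltVar_le {α lam : ℝ} (hlam : 0 < lam) (a b : ℕ) : tiltVar α lam a b ≤ b / lam ^ 2 := by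
  calc tiltVar α lam a b ≤ ∑ _j ∈ Finset.Ico a b, (lam⁻¹) ^ 2 := by
        refine Finset.sum_le_sum fun j _ => ?_
        gcongr
        have : (0 : ℝ) ≤ (j : ℝ) ^ α := by positivity
        linarith
    _ = ((b - a : ℕ) : ℝ) / lam ^ 2 := by simp [div_eq_mul_inv]
    _ ≤ b / lam ^ 2 := by
        gcongr
        exact Nat.sub_le b a

lemma tiltMean_le {α lam : ℝ} (hlam : 0 < lam) (a b : ℕ) : tiltMean α lam a b ≤ b / lam := by
  calc tiltMean α lam a b ≤ ∑ _j ∈ Finset.Ico a b, lam⁻¹ := by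
        refine Finset.sum_le_sum fun j _ => ?_
        gcongr
        have : (0 : ℝ) ≤ (j : ℝ) ^ α := by positivity
        linarith
    _ = ((b - a : ℕ) : ℝ) / lam := by simp [div_eq_mul_inv]
    _ ≤ b / lam := by
        gcongr
        exact Nat.sub_le b a

lemma le_tiltMean {α lam R : ℝ} (hlam : 0 < lam) (a k : ℕ)
    (hR : ∀ j, a ≤ j → j < a + k → (j : ℝ) ^ α ≤ R) :
    k / (R + lam) ≤ tiltMean α lam a (a + k) := by
  calc (k : ℝ) / (R + lam) = ∑ _j ∈ Finset.Ico a (a + k), (R + lam)⁻¹ := by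
        simp [div_eq_mul_inv]
    _ ≤ tiltMean α lam a (a + k) := by
        refine Finset.sum_le_sum fun j hj => ?_
        have hj := Finset.mem_Ico.1 hj
        have := hR j hj.1 hj.2
        gcongr

lemma continuousOn_tiltMean (α : ℝ) (a b : ℕ) :
    ContinuousOn (fun lam => tiltMean α lam a b) (Set.Ioi 0) := by
  unfold tiltMean
  refine continuousOn_finsetSum _ fun j _ => ContinuousOn.inv₀ (by fun_prop) fun lam hlam => ?_
  have : 0 < lam := hlam
  positivity

set_option maxHeartbeats 2000000 in
/-- Choice of the tilt, and comparison of the chance of reaching level `2 m + 1` with that of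
stopping at level `m`. -/
lemma exists_tilt {α : ℝ} (hα : 1 < α) : ∀ᶠ m : ℕ in atTop, ∃ σ w lam μ : ℝ,
    0 < σ ∧ 0 < w ∧ 0 < lam ∧ σ ^ 2 = powTail (2 * α) m ∧ 2 * σ⁻¹ ≤ (m : ℝ) ^ α ∧
    powTail α m - 6 * σ = μ + w ∧ tiltMean α lam 1 m = μ ∧ 2 * tiltVar α lam 1 m ≤ w ^ 2 ∧
    260 * reachBound α lam (powTail α m + 5 * σ) (2 * m + 1) 1 0 ≤
      Real.exp (lam * (μ - w) - (m : ℝ) ^ α * (powTail α m + 5 * σ - μ + w)) *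
        tiltProd α lam 1 m / 2 := by
  have hβ : 0 < α - 1 := by linarith
  set κ : ℝ := 2 ^ α / (α - 1) with hκ
  set κ₂ : ℝ := 2 ^ (2 * α) / (2 * α - 1) with hκ₂
  have hκ₂0 : 0 < κ₂ := div_pos (by positivity) (by linarith)
  -- With tilt `c₁ * r = (m / N) ^ α`, the first `m / N` levels alone have tilted mean at least `N ^
  -- (α - 1) / 4 * (m / r) ≥ κ * (m / r) ≥ powTail α m`.
  obtain ⟨N, hN2, hN⟩ : ∃ N : ℕ, 2 ≤ N ∧ 4 * κ ≤ (N : ℝ) ^ (α - 1) :=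
    ((eventually_ge_atTop 2).and (((tendsto_rpow_atTop hβ).comp
      tendsto_natCast_atTop_atTop).eventually_ge_atTop (4 * κ))).exists
  have hN0 : (0 : ℝ) < N := by exact_mod_cast (by omega)
  set c₁ : ℝ := ((N : ℝ) ^ α)⁻¹ with hc₁
  have hc₁0 : 0 < c₁ := by positivity
  set A : ℝ := 2 ^ α with hA
  have hA1 : 1 ≤ A := Real.one_le_rpow (by norm_num) (by linarith)
  have hA0 : 0 < A := by linarith
  have hc₁1 : c₁ ≤ 1 := inv_le_one_of_one_le₀
    (Real.one_le_rpow (by exact_mod_cast (by omega)) (by linarith))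
  set D : ℝ := 6 * √κ₂ + √2 / c₁ with hD
  set B : ℝ := (2 * A + 1) * (11 * √κ₂ + 2 * (√2 / c₁)) with hB
  set l : ℝ := c₁ / (3 * A) with hl
  have hl0 : 0 < l := by positivity
  have hsqrt : Tendsto (fun m : ℕ => √(m : ℝ)) atTop atTop :=
    Real.tendsto_sqrt_atTop.comp tendsto_natCast_atTop_atTop
  -- In order, these give: `m / N ≥ 2`; `σ ≥ 2 / r`; `l * m / 2 ≥ 7`; `6 * σ + w` at most half of `m
  -- / (A * r)`; `B * √m ≤ l * m / 2`.
  filter_upwards [eventually_ge_atTop (2 * N),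
    (tendsto_natCast_atTop_atTop (R := ℝ)).eventually_ge_atTop (4 * 2 ^ (2 * α)),
    (tendsto_natCast_atTop_atTop (R := ℝ)).eventually_ge_atTop (14 / l),
    hsqrt.eventually_ge_atTop (2 * A * D), hsqrt.eventually_ge_atTop (2 * B / l)]
    with m hmN hm4 hm14 hsD hsB
  have hm0 : (0 : ℝ) < m := by exact_mod_cast (by omega)
  set r : ℝ := (m : ℝ) ^ α with hr
  have hr0 : 0 < r := by positivity
  set s : ℝ := √(m : ℝ) with hs
  have hs0 : 0 < s := Real.sqrt_pos.2 hm0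
  have hss : s * s = m := Real.mul_self_sqrt hm0.le
  have hr2 : (m : ℝ) ^ (2 * α) = r ^ 2 := by
    rw [hr, ← Real.rpow_natCast, ← Real.rpow_mul hm0.le]
    norm_num [mul_comm]
  have hMle : powTail α m ≤ κ * (m / r) := powTail_le hα (by omega)
  have hMge : m / (A * r) ≤ powTail α m := le_powTail hα (by omega)
  have hVle : powTail (2 * α) m ≤ κ₂ * (m / r ^ 2) := hr2 ▸ powTail_le (by linarith) (by omega)
  have hVge : m / (2 ^ (2 * α) * r ^ 2) ≤ powTail (2 * α) m :=
    hr2 ▸ le_powTail (by linarith) (by omega)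
  have hVpos : 0 < powTail (2 * α) m := lt_of_lt_of_le (by positivity) hVge
  set σ : ℝ := √(powTail (2 * α) m) with hσ
  have hσ0 : 0 < σ := Real.sqrt_pos.2 hVpos
  have hσσ : σ ^ 2 = powTail (2 * α) m := Real.sq_sqrt hVpos.le
  have hσle : σ ≤ √κ₂ * s / r := by
    refine abs_le_of_sq_le_sq' ?_ (by positivity) |>.2
    rw [hσσ, div_pow, mul_pow, Real.sq_sqrt hκ₂0.le, sq s, hss, mul_div_assoc]
    exact hVle
  have hσge : 2 / r ≤ σ := by
    refine abs_le_of_sq_le_sq' ?_ hσ0.le |>.2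
    rw [hσσ]
    refine le_trans ?_ hVge
    rw [div_pow, div_le_div_iff₀ (by positivity) (by positivity)]
    nlinarith [mul_le_mul_of_nonneg_right hm4 (sq_nonneg r)]
  -- `w ^ 2` is twice the variance bound `m / lam ^ 2` at the smallest admissible tilt `c₁ * r`.
  set w : ℝ := √2 * s / (c₁ * r) with hw
  have hw0 : 0 < w := by positivity
  have hwe : w = √2 / c₁ * s / r := by rw [hw]; field_simp
  set μ : ℝ := powTail α m - 6 * σ - w with hμ
  have hμge : m / (2 * A * r) ≤ μ := by
    have h1 : 6 * σ + w ≤ D * s / r := by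
      rw [hwe, hD]
      have : (6 * √κ₂ + √2 / c₁) * s / r = 6 * (√κ₂ * s / r) + √2 / c₁ * s / r := by ring
      linarith
    have h2 : D * s / r ≤ m / (2 * A * r) := by
      rw [div_le_div_iff₀ hr0 (by positivity), ← hss]
      nlinarith [mul_le_mul_of_nonneg_right hsD (mul_nonneg hs0.le hr0.le)]
    have h3 : (m : ℝ) / (A * r) = m / (2 * A * r) + m / (2 * A * r) := by field_simp; ring
    linarith
  have hμle : μ ≤ powTail α m := by linarith
  obtain ⟨lam, hlam, hlamμ⟩ : ∃ lam ∈ Set.Icc (c₁ * r) (2 * A * r), tiltMean α lam 1 m = μ := by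
    have hsub : Set.Icc (c₁ * r) (2 * A * r) ⊆ Set.Ioi 0 := fun x hx =>
      lt_of_lt_of_le (by positivity) hx.1
    refine intermediate_value_Icc' (by gcongr; linarith)
      ((continuousOn_tiltMean α 1 m).mono hsub) ⟨?_, ?_⟩
    · exact (tiltMean_le (by positivity) 1 m).trans hμge
    · refine hμle.trans (hMle.trans ?_)
      have hJ1 : 1 + m / N ≤ m := by
        have : m / N ≤ m / 2 := Nat.div_le_div_left hN2 (by norm_num)
        omega
      have hJ2 : (m : ℝ) / (2 * N) ≤ ((m / N : ℕ) : ℝ) := by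
        have h1 : m < N * (m / N) + N := Nat.lt_mul_div_succ m (by omega)
        have h2 : 2 ≤ m / N := (Nat.le_div_iff_mul_le (by omega)).2 hmN
        rw [div_le_iff₀ (by positivity)]
        have h3 : m ≤ m / N * (2 * N) := by nlinarith
        exact_mod_cast h3
      have hmono : tiltMean α (c₁ * r) 1 (1 + m / N) ≤ tiltMean α (c₁ * r) 1 m :=
        Finset.sum_le_sum_of_subset_of_nonneg (Finset.Ico_subset_Ico_right hJ1)
          fun _ _ _ => by positivity
      refine le_trans ?_ ((le_tiltMean (R := c₁ * r) (by positivity) 1 (m / N) ?_).trans hmono)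
      · have h1 : m / (2 * N) / (c₁ * r + c₁ * r) ≤ ((m / N : ℕ) : ℝ) / (c₁ * r + c₁ * r) := by
          gcongr
        refine le_trans ?_ h1
        have h2 : (m : ℝ) / (2 * N) / (c₁ * r + c₁ * r) = (N : ℝ) ^ (α - 1) / 4 * (m / r) := by
          rw [Real.rpow_sub hN0, Real.rpow_one, hc₁]
          field_simp
          ring
        rw [h2]
        gcongr
        linarith
      · intro j _ hj
        have h1 : (j : ℝ) ≤ m / N := by
          have : j ≤ m / N := by omega
          exact (Nat.cast_le.2 this).trans Nat.cast_div_le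
        calc (j : ℝ) ^ α ≤ (m / N : ℝ) ^ α := by gcongr
          _ = c₁ * r := by
            rw [Real.div_rpow hm0.le hN0.le, hc₁, hr]
            field_simp
  have hlam0 : 0 < lam := lt_of_lt_of_le (by positivity) hlam.1
  refine ⟨σ, w, lam, μ, hσ0, hw0, hlam0, hσσ, ?_, by rw [hμ]; ring, hlamμ, ?_, ?_⟩
  · rw [div_le_iff₀ hr0] at hσge
    rw [← div_eq_mul_inv, div_le_iff₀ hσ0]
    linarith
  · have h1 : lam⁻¹ ≤ (c₁ * r)⁻¹ := inv_anti₀ (by positivity) hlam.1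
    calc 2 * tiltVar α lam 1 m ≤ 2 * (m / lam ^ 2) := by
          gcongr
          exact tiltVar_le hlam0 1 m
      _ = 2 * m * (lam⁻¹) ^ 2 := by rw [inv_pow]; ring
      _ ≤ 2 * m * ((c₁ * r)⁻¹) ^ 2 := by gcongr
      _ = w ^ 2 := by
          rw [hw, div_pow, mul_pow, Real.sq_sqrt (by norm_num), sq s, hss, inv_pow]
          ring
  · have hsplit := tiltProd_mul_tiltProd α lam (a := 1) (b := m) (c := 2 * m + 1)
      (by omega) (by omega)
    have hP := tiltProd_nonneg (α := α) hlam0 1 m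
    -- These `m + 1` levels have rates at most `A * r`, so each has tilted mean time at least `1 /
    -- (3 * A * r)`, while `lam ≥ c₁ * r`.
    have hexit : tiltProd α lam m (2 * m + 1) ≤ Real.exp (-(l * m)) := by
      refine (tiltProd_le_exp hlam0 m (2 * m + 1)).trans (Real.exp_le_exp.2 (neg_le_neg ?_))
      have h1 := le_tiltMean (α := α) (R := A * r) hlam0 m (m + 1) fun j hj1 hj2 => by
        rw [hA, hr, ← Real.mul_rpow (by norm_num) hm0.le]
        refine Real.rpow_le_rpow (by positivity) ?_ (by linarith)
        exact_mod_cast (by omega)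
      rw [show m + (m + 1) = 2 * m + 1 by omega] at h1
      have h2 : m / (3 * A * r) ≤ tiltMean α lam m (2 * m + 1) := by
        refine le_trans ?_ h1
        push_cast
        have : A * r + lam ≤ 3 * A * r := by linarith [hlam.2]
        gcongr
        linarith
      calc l * m = c₁ * r * (m / (3 * A * r)) := by rw [hl]; field_simp
        _ ≤ lam * tiltMean α lam m (2 * m + 1) :=
          mul_le_mul hlam.1 h2 (by positivity) hlam0.le
    have hTμ : powTail α m + 5 * σ - μ + w = 11 * σ + 2 * w := by rw [hμ]; ring
    have hexp : (lam + r) * (11 * σ + 2 * w) ≤ B * s := by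
      have h1 : lam + r ≤ (2 * A + 1) * r := by linarith [hlam.2]
      have h2 : 11 * σ + 2 * w ≤ (11 * √κ₂ + 2 * (√2 / c₁)) * s / r := by
        rw [hwe]
        have : (11 * √κ₂ + 2 * (√2 / c₁)) * s / r =
          11 * (√κ₂ * s / r) + 2 * (√2 / c₁ * s / r) := by ring
        linarith
      calc (lam + r) * (11 * σ + 2 * w)
          ≤ ((2 * A + 1) * r) * ((11 * √κ₂ + 2 * (√2 / c₁)) * s / r) :=
            mul_le_mul h1 h2 (by positivity) (by positivity)
        _ = B * s := by rw [hB]; field_simp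
    -- The decisive comparison, `exp (O (√m))` against `exp (-l m)`; `520 = 2 * 260` absorbs the `/
    -- 2` in the goal.
    have hsmall : Real.exp ((lam + r) * (11 * σ + 2 * w)) * tiltProd α lam m (2 * m + 1) ≤
        1 / 520 := by
      calc _ ≤ Real.exp (B * s) * Real.exp (-(l * m)) := by
            have := tiltProd_nonneg (α := α) hlam0 m (2 * m + 1)
            gcongr
        _ = Real.exp (B * s - l * m) := by rw [← Real.exp_add]; ring_nf
        _ ≤ Real.exp (-7) := by
            refine Real.exp_le_exp.2 ?_
            rw [div_le_iff₀ hl0] at hsB hm14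
            have := mul_le_mul_of_nonneg_right hsB hs0.le
            have h3 : s * l * s = m * l := by rw [← hss]; ring
            linarith
        _ ≤ 1 / 520 := (exp_neg_natCast_le 7).trans (by norm_num)
    rw [reachBound, ← hsplit, sub_zero, hTμ]
    have e : Real.exp (lam * (powTail α m + 5 * σ)) =
        Real.exp (lam * (μ - w) - r * (11 * σ + 2 * w)) *
          Real.exp ((lam + r) * (11 * σ + 2 * w)) := by
      rw [← Real.exp_add, ← hTμ]
      ring_nf
    rw [e]
    have h1 := mul_le_mul_of_nonneg_left hsmall
      (mul_nonneg (Real.exp_pos (lam * (μ - w) - r * (11 * σ + 2 * w))).le hP)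
    nlinarith [h1]

/-! ### From compositions at finite steps to the infinite sequence -/

lemma urnTally_eq_count {n : ℕ} (x₀ : Fin (n + 1) → ℕ) (c : ℕ → Fin (n + 1)) (K : ℕ)
    (i : Fin (n + 1)) :
    urnTally x₀ (fun l : Fin K => c l) i = x₀ i + Nat.count (fun k => c k = i) K := by
  rw [urnTally, Nat.count_eq_card_filter_range, Finset.card_filter, Finset.card_filter,
    Finset.sum_range fun k => if c k = i then 1 else 0]

lemma exists_encard_eq_of_count_le {p : ℕ → Prop} [DecidablePred p] {B : ℕ}
    (h : ∀ K, Nat.count p K ≤ B) :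
    ∃ v ≤ B, {k | p k}.encard = v ∧ ∀ᶠ K in atTop, Nat.count p K = v := by
  have hfin : {k | p k}.Finite := by
    by_contra hinf
    have := h (Nat.nth p (B + 1))
    rw [Nat.count_nth_of_infinite hinf] at this
    omega
  obtain ⟨K₀, hK₀⟩ := hfin.bddAbove
  have hK : ∀ K, K₀ < K → Nat.count p K = hfin.toFinset.card := fun K hK => by
    rw [Nat.count_eq_card_filter_range]
    congr 1
    ext k
    simp only [Finset.mem_filter, Finset.mem_range, Set.Finite.mem_toFinset, Set.mem_ofPred_eq,
      and_iff_right_iff_imp]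
    exact fun hk => (hK₀ hk).trans_lt hK
  refine ⟨hfin.toFinset.card, hK (K₀ + 1) (Nat.lt_succ_self _) ▸ h _, ?_, ?_⟩
  · rw [← Set.encard_coe_eq_coe_finsetCard, Set.Finite.coe_toFinset]
  · filter_upwards [eventually_gt_atTop K₀] with K using hK K

/-- The compositions in which a mouse has more than `2 m` balls, or the cat has at least `L` balls
and fewer than five mice have exactly `m` balls. -/
def badCompositions (m L n : ℕ) : Set (Fin (n + 1) → ℕ) :=
  {x | (∃ i : Fin n, 2 * m < x i.succ) ∨
    (L ≤ x 0 ∧ (Finset.univ.filter fun i : Fin n => x i.succ = m).card < 5)}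

/-- Counts are monotone, so a bound that holds infinitely often holds always. The mice are then
selected finitely often, so the cat is selected infinitely often and passes `L`; a good time after
all mice have frozen exhibits the five. -/
lemma selectionCount_of_frequently {m L n : ℕ} (hm : 1 ≤ m) (c : ℕ → Fin (n + 1))
    (h : ∃ᶠ K in atTop,
      urnTally (catAndMice m n) (fun l : Fin K => c l) ∉ badCompositions m L n) :
    (∀ i : Fin (n + 1), ((2 * m - 1 : ℕ) : ℕ∞) < selectionCount c i ↔ i = 0) ∧
      5 ≤ {i : Fin (n + 1) | selectionCount c i = ((m - 1 : ℕ) : ℕ∞)}.ncard := by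
  simp only [badCompositions, Set.mem_ofPred_eq, not_or, not_exists, not_lt, not_and,
    urnTally_eq_count] at h
  have hcount : ∀ (i : Fin n) (K : ℕ), Nat.count (fun k => c k = i.succ) K ≤ 2 * m - 1 := by
    intro i K
    obtain ⟨K', hK', h'⟩ := (frequently_atTop.1 h) K
    have h1 := h'.1 i
    have h2 := Nat.count_monotone (fun k => c k = i.succ) hK'
    simp only [catAndMice, Fin.cons_succ] at h1
    omega
  choose v hv hvenc hvev using fun i : Fin n => exists_encard_eq_of_count_le (hcount i)
  have hcat : {k | c k = 0}.Infinite := by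
    intro hfin
    refine Set.infinite_univ (α := ℕ) ?_
    have : (Set.univ : Set ℕ) = {k | c k = 0} ∪ ⋃ i : Fin n, {k | c k = i.succ} := by
      ext k
      simp only [Set.mem_univ, Set.mem_union, Set.mem_ofPred_eq, Set.mem_iUnion, true_iff]
      rcases Fin.eq_zero_or_eq_succ (c k) with h0 | ⟨i, hi⟩
      · exact Or.inl h0
      · exact Or.inr ⟨i, hi⟩
    rw [this]
    refine hfin.union (Set.finite_iUnion fun i => ?_)
    exact Set.finite_of_encard_eq_coe (hvenc i)
  have hL : ∀ᶠ K in atTop, L ≤ catAndMice m n 0 + Nat.count (fun k => c k = 0) K := by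
    filter_upwards [eventually_ge_atTop (Nat.nth (fun k => c k = 0) L)] with K hK
    have := Nat.count_monotone (fun k => c k = 0) hK
    rw [Nat.count_nth_of_infinite hcat] at this
    omega
  refine ⟨fun i => ?_, ?_⟩
  · rcases Fin.eq_zero_or_eq_succ i with rfl | ⟨i, rfl⟩
    · simp only [selectionCount, hcat.encard_eq, iff_true]
      exact ENat.natCast_lt_top _
    · simp only [selectionCount, hvenc, Fin.succ_ne_zero, iff_false, not_lt]
      exact_mod_cast hv i
  · obtain ⟨K, ⟨h1, h2⟩, hLK, hvK⟩ := (h.and_eventually (hL.and (eventually_all.2 hvev))).exists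
    refine (h2 hLK).trans ?_
    rw [← Finset.card_map (Fin.succEmb n), ← Set.ncard_coe_finset]
    refine Set.ncard_le_ncard ?_ (Set.toFinite _)
    intro j hj
    simp only [Finset.coe_map, Set.mem_image, Finset.mem_coe, Finset.mem_filter, Finset.mem_univ,
      true_and] at hj
    obtain ⟨i, hi, rfl⟩ := hj
    have : v i = m - 1 := by
      rw [hvK i] at hi
      simp only [catAndMice, Fin.cons_succ] at hi
      omega
    simp only [Set.mem_ofPred_eq, selectionCount, Fin.coe_succEmb, hvenc, this]

/-- If the compositions of an urn are in `B` with probability at most `v` at each step, then they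
are outside `B` infinitely often with probability at least `1 - v`. -/
lemma le_measureReal_of_frequently {Ω : Type*} [MeasurableSpace Ω] {μ : Measure Ω}
    [IsProbabilityMeasure μ] {A : ℕ → Set Ω} {v : ℝ} (hA : ∀ k, μ.real (A k) ≤ v) {E : Set Ω}
    (hE : ∀ ω, (∃ᶠ k in atTop, ω ∉ A k) → ω ∈ E) : 1 - v ≤ μ.real E := by
  -- An increasing union whose `N`-th member lies in `A N`: no sum over steps is needed.
  have hsub : Eᶜ ⊆ ⋃ N, ⋂ k ≥ N, A k := by
    intro ω hω
    have h1 : ¬ ∃ᶠ k in atTop, ω ∉ A k := fun h => hω (hE ω h)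
    simp only [not_frequently, not_not, eventually_atTop] at h1
    obtain ⟨N, hN⟩ := h1
    exact Set.mem_iUnion.2 ⟨N, Set.mem_iInter₂.2 hN⟩
  have hmono : Monotone fun N => ⋂ k ≥ N, A k := fun N N' h =>
    Set.biInter_subset_biInter_left fun k hk => le_trans h hk
  have h1 : μ Eᶜ ≤ ENNReal.ofReal v := by
    refine (measure_mono hsub).trans ?_
    rw [hmono.measure_iUnion]
    refine iSup_le fun N => (measure_mono (Set.biInter_subset_of_mem (le_refl N))).trans ?_
    rw [← ofReal_measureReal]
    exact ENNReal.ofReal_le_ofReal (hA N)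
  have hv : 0 ≤ v := measureReal_nonneg.trans (hA 0)
  have h2 : μ.real Eᶜ ≤ v := ENNReal.toReal_le_of_le_ofReal hv h1
  have h3 : μ.real (E ∪ Eᶜ) ≤ μ.real E + μ.real Eᶜ := measureReal_union_le _ _
  rw [Set.union_compl_self, probReal_univ] at h3
  linarith

/-! ### The supersolution for the whole urn -/

/-- The supersolution that controls the probability of a bad composition. -/
noncomputable def catMiceBound (α σ w lam μ : ℝ) (m n : ℕ) (x : Fin (n + 1) → ℕ) (t : ℝ) : ℝ :=
  Real.exp (σ⁻¹ * t + (-(σ⁻¹ * (powTail α m + 5 * σ)) + σ⁻¹ * powTail α (x 0) +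
      σ⁻¹ ^ 2 * powTail (2 * α) (x 0))) +
    Real.exp (-σ⁻¹ * t + (σ⁻¹ * (powTail α m - 5 * σ) - σ⁻¹ * powTail α (x 0) +
      σ⁻¹ ^ 2 * powTail (2 * α) (x 0))) +
    ∑ i : Fin n, reachBound α lam (powTail α m + 5 * σ) (2 * m + 1) (x i.succ) t +
    16 * ∏ i : Fin n, (1 - stayBound α lam (powTail α m + 5 * σ) μ w m (x i.succ) t / 2)

lemma isUrnSupersolution_catMiceBound {α σ w lam μ : ℝ} (hα : 1 < α) {m : ℕ} (n : ℕ) (hm : 1 ≤ m)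
    (hσ : 0 < σ) (hw : 0 < w) (hlam : 0 < lam) (hσm : 2 * σ⁻¹ ≤ (m : ℝ) ^ α)
    (hμ : powTail α m - 6 * σ = μ + w) :
    IsUrnSupersolution α (powTail α m + 5 * σ) (catAndMice m n)
      (catMiceBound α σ w lam μ m n) := by
  have hT : μ - w ≤ powTail α m + 5 * σ := by linarith
  have h0 : catAndMice m n 0 = m := rfl
  refine IsUrnSupersolution.add (IsUrnSupersolution.add (IsUrnSupersolution.add ?_ ?_) ?_) ?_
  · exact IsBirthSupersolution.urn 0
      (h0 ▸ isBirthSupersolution_late hα _ hm (by positivity) hσm)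
  · exact IsBirthSupersolution.urn 0
      (h0 ▸ isBirthSupersolution_early hα _ _ (θ := σ⁻¹) hm (by positivity))
  · exact IsUrnSupersolution.sum _ fun i _ =>
      IsBirthSupersolution.urn i.succ (isBirthSupersolution_reachBound hlam _ _ _)
  · have h1 := IsUrnSupersolution.prod (α := α) (T := powTail α m + 5 * σ) (b := catAndMice m n)
      (h := Fin.cons (fun _ _ => 1) fun _ a t =>
        1 - stayBound α lam (powTail α m + 5 * σ) μ w m a t / 2) ?_ ?_
    · simp only [Fin.prod_univ_succ, Fin.cons_zero, Fin.cons_succ, one_mul] at h1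
      exact h1.const_mul (by norm_num)
    · intro i
      rcases Fin.eq_zero_or_eq_succ i with rfl | ⟨i, rfl⟩
      · exact fun a _ t _ => ⟨0, hasDerivAt_const _ _, by simp⟩
      · simpa only [Fin.cons_succ] using isBirthSupersolution_stayBound hlam hw m _
    · intro i a t _ ht
      rcases Fin.eq_zero_or_eq_succ i with rfl | ⟨i, rfl⟩
      · simp
      · have := stayBound_le_one (α := α) hlam hw hT m a ht
        simp only [Fin.cons_succ]
        linarith

section CatMiceBound

variable {α σ w lam μ : ℝ} {m n : ℕ}

lemma prod_one_sub_stayBound_nonneg (hw : 0 < w) (hlam : 0 < lam) (hσ : 0 < σ)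
    (hμ : powTail α m - 6 * σ = μ + w) (x : Fin (n + 1) → ℕ) {t : ℝ}
    (ht : t ≤ powTail α m + 5 * σ) :
    0 ≤ ∏ i : Fin n, (1 - stayBound α lam (powTail α m + 5 * σ) μ w m (x i.succ) t / 2) := by
  refine Finset.prod_nonneg fun i _ => ?_
  have := stayBound_le_one (α := α) (μ := μ) hlam hw (by linarith) m (x i.succ) ht
  linarith

lemma one_le_catMiceBound_terminal (hσ : 0 < σ) (hw : 0 < w) (hlam : 0 < lam)
    (hμ : powTail α m - 6 * σ = μ + w) (x : Fin (n + 1) → ℕ) :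
    1 ≤ catMiceBound α σ w lam μ m n x (powTail α m + 5 * σ) := by
  have h1 : 0 ≤ ∑ i : Fin n, reachBound α lam (powTail α m + 5 * σ) (2 * m + 1) (x i.succ)
      (powTail α m + 5 * σ) := Finset.sum_nonneg fun i _ => reachBound_nonneg hlam _ _ _ _
  have h2 := prod_one_sub_stayBound_nonneg hw hlam hσ hμ x le_rfl
  have h3 : 0 ≤ σ⁻¹ * powTail α (x 0) := mul_nonneg (by positivity) (powTail_nonneg _ _)
  have h4 : 0 ≤ σ⁻¹ ^ 2 * powTail (2 * α) (x 0) := mul_nonneg (by positivity) (powTail_nonneg _ _)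
  have h5 : 1 ≤ Real.exp (σ⁻¹ * (powTail α m + 5 * σ) + (-(σ⁻¹ * (powTail α m + 5 * σ)) +
      σ⁻¹ * powTail α (x 0) + σ⁻¹ ^ 2 * powTail (2 * α) (x 0))) :=
    Real.one_le_exp (by linarith)
  unfold catMiceBound
  have h6 := Real.exp_pos (-σ⁻¹ * (powTail α m + 5 * σ) + (σ⁻¹ * (powTail α m - 5 * σ) -
    σ⁻¹ * powTail α (x 0) + σ⁻¹ ^ 2 * powTail (2 * α) (x 0)))
  linarith

lemma indicator_le_catMiceBound (hα : 1 < α) (hσ : 0 < σ) (hw : 0 < w) (hlam : 0 < lam)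
    (hμ : powTail α m - 6 * σ = μ + w) {L : ℕ} (hL : powTail α L ≤ σ) (x : Fin (n + 1) → ℕ)
    {t : ℝ} (ht : t ≤ powTail α m + 5 * σ) :
    (badCompositions m L n).indicator 1 x ≤ catMiceBound α σ w lam μ m n x t := by
  have h1 : ∀ i : Fin n, 0 ≤ reachBound α lam (powTail α m + 5 * σ) (2 * m + 1) (x i.succ) t :=
    fun i => reachBound_nonneg hlam _ _ _ _
  have h1' := Finset.sum_nonneg fun i (_ : i ∈ Finset.univ) => h1 i
  have h2 := prod_one_sub_stayBound_nonneg hw hlam hσ hμ x ht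
  have h3 := Real.exp_pos (σ⁻¹ * t + (-(σ⁻¹ * (powTail α m + 5 * σ)) + σ⁻¹ * powTail α (x 0) +
      σ⁻¹ ^ 2 * powTail (2 * α) (x 0)))
  have h4 := Real.exp_pos (-σ⁻¹ * t + (σ⁻¹ * (powTail α m - 5 * σ) - σ⁻¹ * powTail α (x 0) +
      σ⁻¹ ^ 2 * powTail (2 * α) (x 0)))
  unfold catMiceBound
  by_cases hx : x ∈ badCompositions m L n
  · rw [Set.indicator_of_mem hx, Pi.one_apply]
    rcases hx with ⟨i, hi⟩ | ⟨hxL, hcard⟩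
    · have h5 := one_le_reachBound (α := α) hlam ht (a := x i.succ) (b := 2 * m + 1) (by omega)
      have h6 := Finset.single_le_sum (fun i _ => h1 i) (Finset.mem_univ i)
      linarith
    -- Up to `μ + w = powTail α m - 6 * σ`, a cat with `L` balls has mean remaining time at most
    -- `σ`, so the early-explosion term is at least `1`. Later, only mice exactly at `m` can have a
    -- factor below `1`; there are at most four and each factor is at least `1 / 2`, whence the
    -- constant `16`.
    · rcases le_or_gt t (μ + w) with htμ | htμ
      · have h5 : powTail α (x 0) ≤ σ := (powTail_antitone hα hxL).trans hL
        have h6 : 0 ≤ σ⁻¹ ^ 2 * powTail (2 * α) (x 0) :=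
          mul_nonneg (by positivity) (powTail_nonneg _ _)
        have h7 : 0 ≤ σ⁻¹ * (powTail α m - 5 * σ - t - powTail α (x 0)) :=
          mul_nonneg (by positivity) (by linarith)
        have h8 : 1 ≤ Real.exp (-σ⁻¹ * t + (σ⁻¹ * (powTail α m - 5 * σ) - σ⁻¹ * powTail α (x 0) +
            σ⁻¹ ^ 2 * powTail (2 * α) (x 0))) := Real.one_le_exp (by linarith)
        linarith
      · have h5 : ∏ i : Fin n, (if x i.succ = m then (1 / 2 : ℝ) else 1) ≤
            ∏ i : Fin n, (1 - stayBound α lam (powTail α m + 5 * σ) μ w m (x i.succ) t / 2) := by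
          refine Finset.prod_le_prod (fun i _ => by split_ifs <;> norm_num) fun i _ => ?_
          split_ifs with h
          · have := stayBound_le_one (α := α) (μ := μ) hlam hw (by linarith) m (x i.succ) ht
            linarith
          · have := stayBound_nonpos (α := α) (T := powTail α m + 5 * σ) hlam hw h htμ.le
            linarith
        rw [Finset.prod_ite, Finset.prod_const, Finset.prod_const_one, mul_one] at h5
        have h6 : (1 / 2 : ℝ) ^ 4 ≤
            (1 / 2) ^ (Finset.univ.filter fun i : Fin n => x i.succ = m).card :=
          pow_le_pow_of_le_one (by norm_num) (by norm_num) (by omega)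
        norm_num at h6
        norm_num at h5
        linarith
  · rw [Set.indicator_of_notMem hx]
    linarith

/-- Both Chernoff exponents are `-5 + 1`: five standard deviations with `θ = σ⁻¹`, plus `θ ^ 2 * σ ^
2 = 1`. -/
lemma catMiceBound_initial_le (hσ : 0 < σ) (hσσ : σ ^ 2 = powTail (2 * α) m) {p : ℝ}
    (hp1 : stayBound α lam (powTail α m + 5 * σ) μ w m 1 0 ≤ 1)
    (hp : p ≤ stayBound α lam (powTail α m + 5 * σ) μ w m 1 0) :
    catMiceBound α σ w lam μ m n (catAndMice m n) 0 ≤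
      2 * Real.exp (-4) + n * reachBound α lam (powTail α m + 5 * σ) (2 * m + 1) 1 0 +
        16 * Real.exp (-(n * p / 2)) := by
  have h0 : catAndMice m n 0 = m := rfl
  have hi : ∀ i : Fin n, catAndMice m n i.succ = 1 := fun i => rfl
  simp only [catMiceBound, h0, hi, Finset.sum_const, Finset.prod_const, Finset.card_univ,
    Fintype.card_fin, nsmul_eq_mul, ← hσσ]
  have e1 : σ⁻¹ * 0 + (-(σ⁻¹ * (powTail α m + 5 * σ)) + σ⁻¹ * powTail α m + σ⁻¹ ^ 2 * σ ^ 2) =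
      -4 := by field_simp; ring
  have e2 : -σ⁻¹ * 0 + (σ⁻¹ * (powTail α m - 5 * σ) - σ⁻¹ * powTail α m + σ⁻¹ ^ 2 * σ ^ 2) =
      -4 := by field_simp; ring
  rw [e1, e2]
  have h1 : (1 - stayBound α lam (powTail α m + 5 * σ) μ w m 1 0 / 2) ^ n ≤
      Real.exp (-(n * p / 2)) := by
    calc _ ≤ Real.exp (-(p / 2)) ^ n := by
          refine pow_le_pow_left₀ (by linarith) ?_ n
          have := Real.add_one_le_exp (-(p / 2))
          linarith
      _ = Real.exp (-(n * p / 2)) := by rw [← Real.exp_nat_mul]; ring_nf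
  linarith

end CatMiceBound

/-! ### Conclusion -/

theorem theorem1 (α : ℝ) (hα : 1 < α) :
    ∃ m₀ : ℕ, ∀ m : ℕ, m₀ ≤ m → ∃ n : ℕ, 5 ≤ n ∧
      ∀ (Ω : Type*) [MeasurableSpace Ω] (μ : Measure Ω) [IsProbabilityMeasure μ]
        (C : ℕ → Ω → Fin (n + 1)), IsPolyaUrn μ α (catAndMice m n) C →
        4 / 5 < μ.real {ω |
          (∀ i : Fin (n + 1),
            ((2 * m - 1 : ℕ) : ℕ∞) < selectionCount (fun k => C k ω) i ↔ i = 0) ∧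
          5 ≤ {i : Fin (n + 1) |
            selectionCount (fun k => C k ω) i = ((m - 1 : ℕ) : ℕ∞)}.ncard} := by
  obtain ⟨m₀, hm₀⟩ := eventually_atTop.1 ((exists_tilt hα).and (eventually_ge_atTop 2))
  refine ⟨m₀, fun m hm => ?_⟩
  obtain ⟨⟨σ, w, lam, ν, hσ, hw, hlam, hσσ, hσm, hν, hmean, hvar, hreach⟩, hm2⟩ := hm₀ m hm
  set T := powTail α m + 5 * σ with hT
  set p := Real.exp (lam * (ν - w) - (m : ℝ) ^ α * (T - ν + w)) * tiltProd α lam 1 m / 2 with hp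
  have hp0 : 0 < p := by
    have := tiltProd_pos (α := α) hlam le_rfl m
    positivity
  have hps : p ≤ stayBound α lam T ν w m 1 0 :=
    exp_mul_tiltProd_le_stayBound hlam hw (by omega) hmean hvar
  have hT0 : 0 ≤ T := add_nonneg (powTail_nonneg _ _) (by positivity)
  have hs1 : stayBound α lam T ν w m 1 0 ≤ 1 :=
    stayBound_le_one hlam hw (by linarith) m 1 hT0
  have hp1 : p ≤ 1 := hps.trans hs1
  -- `n * p ≥ 12` makes `16 * exp (-(n * p / 2)) ≤ 1 / 20`; `n * p ≤ 13` bounds the chance of a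
  -- mouse above `2 m` by `13 / 260 = 1 / 20`. The cat contributes `2 * exp (-4) < 1 / 10`, for a
  -- total below `1 / 5`.
  obtain ⟨n, hn⟩ : ∃ n : ℕ, n = ⌈12 / p⌉₊ := ⟨_, rfl⟩
  have hn1 : 12 ≤ n * p := by
    rw [← div_le_iff₀ hp0, hn]
    exact Nat.le_ceil _
  have hn2 : n * p ≤ 13 := by
    have h1 : (n : ℝ) < 12 / p + 1 := hn ▸ Nat.ceil_lt_add_one (by positivity)
    have h2 := mul_lt_mul_of_pos_right h1 hp0
    rw [add_mul, div_mul_cancel₀ _ hp0.ne'] at h2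
    linarith
  refine ⟨n, ?_, fun Ω _ μ _ C hC => ?_⟩
  · have : (12 : ℝ) ≤ n := hn1.trans (mul_le_of_le_one_right (by positivity) hp1)
    have : 12 ≤ n := by exact_mod_cast this
    omega
  obtain ⟨L, hL⟩ := ((tendsto_powTail α).eventually_le_const hσ).exists
  have hbad : ∀ k, μ.real {ω | urnTally (catAndMice m n) (fun l : Fin k => C l ω) ∈
      badCompositions m L n} ≤ catMiceBound α σ w lam ν m n (catAndMice m n) 0 := by
    intro k
    rw [hC.measureReal_tally_mem]
    refine (isUrnSupersolution_catMiceBound hα n (by omega) hσ hw hlam hσm hν).urnValue_le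
      ?_ ?_ ?_ k _ le_rfl 0 hT0
    · exact fun x => Set.indicator_le_self' (fun _ _ => zero_le_one) x
    · exact fun x _ => one_le_catMiceBound_terminal hσ hw hlam hν x
    · exact fun x _ t ht => indicator_le_catMiceBound hα hσ hw hlam hν hL x ht
  refine lt_of_lt_of_le ?_ (le_measureReal_of_frequently hbad fun ω hω =>
    selectionCount_of_frequently (by omega) (fun k => C k ω) hω)
  have h1 := catMiceBound_initial_le (n := n) hσ hσσ hs1 hps
  have h2 : Real.exp (-4) < 1 / 20 := (exp_neg_natCast_le 4).trans_lt (by norm_num)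
  have h3 : Real.exp (-(n * p / 2)) ≤ 1 / 320 :=
    (Real.exp_le_exp.2 (show -(n * p / 2) ≤ -(6 : ℕ) by push_cast; linarith)).trans
      ((exp_neg_natCast_le 6).trans (by norm_num))
  have h4 : n * reachBound α lam T (2 * m + 1) 1 0 ≤ 1 / 20 := by
    have := mul_le_mul_of_nonneg_left hreach (Nat.cast_nonneg (α := ℝ) n)
    linarith
  linarith
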